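/- **Setting.** A finite PO-DTMC for $k$ agents is a tuple $M=(S,PI,PT,O_1,\dots,O_k,\pi)$ with $S$ a finite set of states, $PI$ a rational probability distribution on $S$, $PT$ a rational stochastic $S\times S$ matrix, observation functions $O_i$ on $S$, and $\pi(s)$ a finite set of atomic propositions for each $s\in S$. Its runs are the infinite sequences $r(0)r(1)\dots$ of states with $PI(r(0))>0$ and $PT(r(m),r(m+1))>0$ for all $m$; they carry the probability measure $\mu$ determined by $\mu(\{r : r(0)\dots r(m)=s_0\dots s_m\})=PI(s_0)\prod_{j<m}PT(s_j,s_{j+1})$. Formulas of the logic $\mathrm{WMLOKP}$ are built from time variables $t$ (ranging over $\mathbb N$) and set variables $X$ (ranging over finite subsets of $\mathbb N$) by $$\phi ::= p(t)\mid X(t)\mid t_1<t_2\mid f(P,\dots,P)\bowtie c\mid\neg\phi\mid\phi\wedge\phi\mid K_{i,t}(\phi)\mid\forall t(\phi)\mid\forall X(\phi),$$ where $p$ is an atomic proposition, $f$ is a rational polynomial, $c\in\mathbb Q$, ${\bowtie}\in\{=,<,\le,>,\ge\}$, and each probability term $P$ is either a global term $\Pr(\phi)$ or an agent term $\Pr_{i,t}(\phi)$.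 Formulas are interpreted on a run $r$ relative to an assignment $\tau$ of values to the variables: $p(t)$ holds if $p\in\pi(r(\tau(t)))$, the value of $\Pr(\phi)$ is the measure $\mu$ of the set of runs that satisfy $\phi$ under $\tau$, $K_{i,t}\phi$ and $\Pr_{i,t}(\phi)$ express knowledge and conditional probability given the local state of agent $i$ at time $\tau(t)$ (either with synchronous perfect recall or with the clock semantics), and the other constructs have their usual meaning. For a sentence $\phi$ (no free variables), $M\models\phi$ means that $\phi$ holds on all runs of $M$. Consider the fragment of $\mathrm{WMLOKP}$ without $K_{i,t}$ and $\Pr_{i,t}$, in which all probability comparisons have the form $a_1\Pr(\phi_1)+\dots+a_n\Pr(\phi_n)\bowtie c$ with $a_j,c\in\mathbb Q$, and in which quantifiers, in particular the second-order quantifiers $\forall X$, may bind variables inside probability terms ("quantifying-in"). **Theorem.** For every number $k$ of agents, and with either of the two semantics for agents, it is undecidable, given a finite PO-DTMC $M$ for $k$ agents and a sentence $\phi$ of this fragment, whether $M\models\phi$. -/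

import Mathlib

namespace WMLO

open MeasureTheory ProbabilityTheory

/-! ### Partially observed Markov chains -/

/-- A finite interpreted partially observed discrete-time Markov chain for `k` agents, presented as
a finite object: the states are `0, …, numStates - 1`, the probabilities are rational, observations
and atomic propositions are named by natural numbers, and each state satisfies finitely many
atomic propositions. -/
structure PODTMC (k : ℕ) where
  numStates : ℕ
  PI : Fin numStates → ℚ
  PI_nonneg : ∀ s, 0 ≤ PI s
  PI_sum : ∑ s, PI s = 1
  PT : Fin numStates → Fin numStates → ℚ
  PT_nonneg : ∀ s t, 0 ≤ PT s t
  PT_sum : ∀ s, ∑ t, PT s t = 1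
  obs : Fin k → Fin numStates → ℕ
  interp : Fin numStates → Finset ℕ

namespace PODTMC

variable {k : ℕ} (M : PODTMC k)

/-- The initial distribution as a probability mass function. -/
noncomputable def initPMF : PMF (Fin M.numStates) :=
  PMF.ofFintype (fun s => ENNReal.ofReal ((M.PI s : ℚ) : ℝ)) (by
    rw [← ENNReal.ofReal_sum_of_nonneg (fun s _ => by exact_mod_cast M.PI_nonneg s)]
    have h : ∑ s, ((M.PI s : ℚ) : ℝ) = 1 := by exact_mod_cast M.PI_sum
    rw [h, ENNReal.ofReal_one])

/-- The distribution of the successor of the state `s`. -/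
noncomputable def stepPMF (s : Fin M.numStates) : PMF (Fin M.numStates) :=
  PMF.ofFintype (fun t => ENNReal.ofReal ((M.PT s t : ℚ) : ℝ)) (by
    rw [← ENNReal.ofReal_sum_of_nonneg (fun t _ => by exact_mod_cast M.PT_nonneg s t)]
    have h : ∑ t, ((M.PT s t : ℚ) : ℝ) = 1 := by exact_mod_cast M.PT_sum s
    rw [h, ENNReal.ofReal_one])

/-- The one-step transition kernel. -/
noncomputable def stepKernel : Kernel (Fin M.numStates) (Fin M.numStates) :=
  Kernel.ofFunOfCountable (fun s => (M.stepPMF s).toMeasure)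

instance : IsMarkovKernel M.stepKernel :=
  ⟨fun s => by
    change IsProbabilityMeasure (M.stepPMF s).toMeasure
    infer_instance⟩

/-- The transition kernel from histories up to time `m` to the state at time `m + 1`. -/
noncomputable def histKernel (m : ℕ) :
    Kernel (Π _ : Finset.Iic m, Fin M.numStates) (Fin M.numStates) :=
  M.stepKernel.comap (fun h => h ⟨m, Finset.mem_Iic.2 le_rfl⟩) (measurable_pi_apply _)

instance (m : ℕ) : IsMarkovKernel (M.histKernel m) := by
  unfold histKernel
  infer_instance

/-- The law of the chain on the space of all infinite sequences of states, which carries the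
product `σ`-algebra. -/
noncomputable def seqMeasure : Measure (ℕ → Fin M.numStates) :=
  Kernel.trajMeasure (X := fun _ => Fin M.numStates) M.initPMF.toMeasure M.histKernel

/-- The infinite paths: sequences of states all of whose transitions have positive probability and
whose first state has positive initial probability. -/
abbrev Path : Type :=
  {ρ : ℕ → Fin M.numStates // M.PI (ρ 0) ≠ 0 ∧ ∀ m, 0 < M.PT (ρ m) (ρ (m + 1))}

/-- The probability measure on the infinite paths. The `σ`-algebra on paths is the trace of the
product `σ`-algebra, that is, it is generated by the sets of paths with a given finite prefix. -/
noncomputable def pathMeasure : Measure M.Path :=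
  M.seqMeasure.comap Subtype.val

end PODTMC

/-! ### Local states of the agents -/

/-- What agents remember: synchronous perfect recall or clock semantics. -/
inductive Recall
  | spr
  | clk

namespace PODTMC

variable {k : ℕ} (M : PODTMC k)

/-- The local state of agent `i` at time `m` on the path `ρ`: with perfect recall, the sequence of
all observations made so far; in the clock semantics, the time and the current observation. -/
def localState (x : Recall) (i : Fin k) (ρ : M.Path) (m : ℕ) : List ℕ :=
  match x with
  | .spr => (List.range (m + 1)).map (fun j => M.obs i (ρ.1 j))
  | .clk => [m, M.obs i (ρ.1 m)]

end PODTMC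

/-! ### Syntax -/

/-- The comparison symbols. -/
inductive Cmp
  | eq
  | lt
  | le
  | gt
  | ge

mutual

/-- Formulas of the weak monadic second order logic of order, knowledge and probability for `k`
agents. Atomic propositions, time variables and set variables are named by natural numbers; time
variables and set variables are two separate sorts. -/
inductive Formula (k : ℕ) : Type
  /-- `p(t)` for an atomic proposition `p` -/
  | prop (p t : ℕ) : Formula k
  /-- `X(t)` for a set variable `X` -/
  | mem (X t : ℕ) : Formula k
  /-- `t < u` -/
  | lt (t u : ℕ) : Formula k
  /-- `f(P, …, P) ⋈ c` for a rational constant `c` -/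
  | cmp (e : PExpr k) (r : Cmp) (c : ℚ) : Formula k
  | neg (φ : Formula k) : Formula k
  | and (φ ψ : Formula k) : Formula k
  /-- `K_{i,t} φ` -/
  | know (i : Fin k) (t : ℕ) (φ : Formula k) : Formula k
  /-- `∀ t φ` for a time variable `t` -/
  | allTime (t : ℕ) (φ : Formula k) : Formula k
  /-- `∀ X φ` for a set variable `X` -/
  | allSet (X : ℕ) (φ : Formula k) : Formula k

/-- Probability expressions `f(P, …, P)`: polynomials with rational coefficients in probability
terms, built from constants and probability terms by addition and multiplication. -/
inductive PExpr (k : ℕ) : Type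
  | const (q : ℚ) : PExpr k
  /-- the global probability term `Pr(φ)` -/
  | pr (φ : Formula k) : PExpr k
  /-- the agent probability term `Pr_{i,t}(φ)` -/
  | prAgent (i : Fin k) (t : ℕ) (φ : Formula k) : PExpr k
  | add (e₁ e₂ : PExpr k) : PExpr k
  | mul (e₁ e₂ : PExpr k) : PExpr k

end

mutual

/-- The time variables that occur free. -/
def Formula.freeTime {k : ℕ} : Formula k → Finset ℕ
  | .prop _ t => {t}
  | .mem _ t => {t}
  | .lt t u => {t, u}
  | .cmp e _ _ => e.freeTime
  | .neg φ => φ.freeTime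
  | .and φ ψ => φ.freeTime ∪ ψ.freeTime
  | .know _ t φ => insert t φ.freeTime
  | .allTime t φ => φ.freeTime.erase t
  | .allSet _ φ => φ.freeTime

/-- The time variables that occur free in a probability expression. -/
def PExpr.freeTime {k : ℕ} : PExpr k → Finset ℕ
  | .const _ => ∅
  | .pr φ => φ.freeTime
  | .prAgent _ t φ => insert t φ.freeTime
  | .add e₁ e₂ => e₁.freeTime ∪ e₂.freeTime
  | .mul e₁ e₂ => e₁.freeTime ∪ e₂.freeTime

end

mutual

/-- The set variables that occur free. -/
def Formula.freeSet {k : ℕ} : Formula k → Finset ℕ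
  | .prop _ _ => ∅
  | .mem X _ => {X}
  | .lt _ _ => ∅
  | .cmp e _ _ => e.freeSet
  | .neg φ => φ.freeSet
  | .and φ ψ => φ.freeSet ∪ ψ.freeSet
  | .know _ _ φ => φ.freeSet
  | .allTime _ φ => φ.freeSet
  | .allSet X φ => φ.freeSet.erase X

/-- The set variables that occur free in a probability expression. -/
def PExpr.freeSet {k : ℕ} : PExpr k → Finset ℕ
  | .const _ => ∅
  | .pr φ => φ.freeSet
  | .prAgent _ _ φ => φ.freeSet
  | .add e₁ e₂ => e₁.freeSet ∪ e₂.freeSet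
  | .mul e₁ e₂ => e₁.freeSet ∪ e₂.freeSet

end

/-- A sentence is a formula without free variables of either sort. -/
def Formula.IsSentence {k : ℕ} (φ : Formula k) : Prop :=
  φ.freeTime = ∅ ∧ φ.freeSet = ∅

mutual

/-- The fragment without knowledge operators in which every probability comparison is between a
linear combination of global probability terms `Pr(φ)` and a constant. Quantifiers of both sorts may
occur anywhere; in particular a set quantifier may bind occurrences inside probability terms. -/
def Formula.LinearGlobal {k : ℕ} : Formula k → Prop
  | .prop _ _ => True
  | .mem _ _ => True
  | .lt _ _ => True
  | .cmp e _ _ => e.LinearGlobal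
  | .neg φ => φ.LinearGlobal
  | .and φ ψ => φ.LinearGlobal ∧ ψ.LinearGlobal
  | .know _ _ _ => False
  | .allTime _ φ => φ.LinearGlobal
  | .allSet _ φ => φ.LinearGlobal

/-- Linear combinations, with rational coefficients, of terms `Pr(φ)` with `φ` in the fragment. -/
def PExpr.LinearGlobal {k : ℕ} : PExpr k → Prop
  | .pr φ => φ.LinearGlobal
  | .add e₁ e₂ => e₁.LinearGlobal ∧ e₂.LinearGlobal
  | .mul (.const _) e => e.LinearGlobal
  | .mul _ _ => False
  | .const _ => False
  | .prAgent _ _ _ => False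

end

/-! ### Semantics -/

/-- The meaning of a comparison symbol. -/
def Cmp.Holds : Cmp → ℝ → ℝ → Prop
  | .eq, a, b => a = b
  | .lt, a, b => a < b
  | .le, a, b => a ≤ b
  | .gt, a, b => a > b
  | .ge, a, b => a ≥ b

/-- An assignment of natural numbers to time variables and of finite sets of natural numbers to set
variables. -/
structure Assignment where
  time : ℕ → ℕ
  set : ℕ → Finset ℕ

/-- `τ[t ↦ n]` for a time variable. -/
def Assignment.updTime (τ : Assignment) (t n : ℕ) : Assignment :=
  ⟨Function.update τ.time t n, τ.set⟩

/-- `τ[X ↦ U]` for a set variable. -/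
def Assignment.updSet (τ : Assignment) (X : ℕ) (U : Finset ℕ) : Assignment :=
  ⟨τ.time, Function.update τ.set X U⟩

mutual

/-- Satisfaction of a formula on the run given by the path `ρ`. -/
noncomputable def Formula.Sat {k : ℕ} (M : PODTMC k) (x : Recall) : Formula k → Assignment → M.Path → Prop
  | .prop p t, τ, ρ => p ∈ M.interp (ρ.1 (τ.time t))
  | .mem X t, τ, _ => τ.time t ∈ τ.set X
  | .lt t u, τ, _ => τ.time t < τ.time u
  | .cmp e r c, τ, ρ => r.Holds (e.val M x τ ρ) (c : ℝ)
  | .neg φ, τ, ρ => ¬ φ.Sat M x τ ρ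
  | .and φ ψ, τ, ρ => φ.Sat M x τ ρ ∧ ψ.Sat M x τ ρ
  | .know i t φ, τ, ρ => ∀ (ρ' : M.Path) (m' : ℕ),
      M.localState x i ρ' m' = M.localState x i ρ (τ.time t) → φ.Sat M x τ ρ'
  | .allTime t φ, τ, ρ => ∀ n : ℕ, φ.Sat M x (τ.updTime t n) ρ
  | .allSet X φ, τ, ρ => ∀ U : Finset ℕ, φ.Sat M x (τ.updSet X U) ρ

/-- The value of a probability expression on the run given by the path `ρ`. -/
noncomputable def PExpr.val {k : ℕ} (M : PODTMC k) (x : Recall) :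
    PExpr k → Assignment → M.Path → ℝ
  | .const q, _, _ => (q : ℝ)
  | .pr φ, τ, _ => M.pathMeasure.real {ρ' | φ.Sat M x τ ρ'}
  | .prAgent i t φ, τ, ρ =>
      M.pathMeasure.real {ρ' | M.localState x i ρ (τ.time t) = M.localState x i ρ' (τ.time t) ∧
          φ.Sat M x τ ρ'} /
        M.pathMeasure.real {ρ' | M.localState x i ρ (τ.time t) = M.localState x i ρ' (τ.time t)}
  | .add e₁ e₂, τ, ρ => e₁.val M x τ ρ + e₂.val M x τ ρ
  | .mul e₁ e₂, τ, ρ => e₁.val M x τ ρ * e₂.val M x τ ρ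

end

/-- `M ⊨ φ`: the formula holds on all runs. For a sentence the assignment is irrelevant. -/
def PODTMC.Models {k : ℕ} (M : PODTMC k) (x : Recall) (φ : Formula k) : Prop :=
  ∀ (τ : Assignment) (ρ : M.Path), φ.Sat M x τ ρ

/-! ### Finite descriptions, as inputs of algorithms -/

/-- The code of a rational number: its numerator and denominator in lowest terms. -/
def ratCode (q : ℚ) : ℕ := Nat.pair (Encodable.encode q.num) q.den

/-- The code of a comparison symbol. -/
def Cmp.code : Cmp → ℕ
  | .eq => 0
  | .lt => 1
  | .le => 2
  | .gt => 3
  | .ge => 4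

/-- The description of a chain: the number of states, and the tables of the initial distribution, of
the transition probabilities, of the observations of each agent, and of the atomic propositions that
hold at each state. -/
def PODTMC.code {k : ℕ} (M : PODTMC k) :
    ℕ × List ℕ × List (List ℕ) × List (List ℕ) × List (List ℕ) :=
  (M.numStates,
    List.ofFn (fun s => ratCode (M.PI s)),
    List.ofFn (fun s => List.ofFn (fun t => ratCode (M.PT s t))),
    List.ofFn (fun i => List.ofFn (fun s => M.obs i s)),
    List.ofFn (fun s => (M.interp s).sort (· ≤ ·)))

mutual

/-- The Gödel number of a formula. -/
def Formula.code {k : ℕ} : Formula k → ℕ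
  | .prop p t => Nat.pair 0 (Nat.pair p t)
  | .mem X t => Nat.pair 1 (Nat.pair X t)
  | .lt t u => Nat.pair 2 (Nat.pair t u)
  | .cmp e r c => Nat.pair 3 (Nat.pair e.code (Nat.pair r.code (ratCode c)))
  | .neg φ => Nat.pair 4 φ.code
  | .and φ ψ => Nat.pair 5 (Nat.pair φ.code ψ.code)
  | .know i t φ => Nat.pair 6 (Nat.pair i (Nat.pair t φ.code))
  | .allTime t φ => Nat.pair 7 (Nat.pair t φ.code)
  | .allSet X φ => Nat.pair 8 (Nat.pair X φ.code)

/-- The Gödel number of a probability expression. -/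
def PExpr.code {k : ℕ} : PExpr k → ℕ
  | .const q => Nat.pair 0 (ratCode q)
  | .pr φ => Nat.pair 1 φ.code
  | .prAgent i t φ => Nat.pair 2 (Nat.pair i (Nat.pair t φ.code))
  | .add e₁ e₂ => Nat.pair 3 (Nat.pair e₁.code e₂.code)
  | .mul e₁ e₂ => Nat.pair 4 (Nat.pair e₁.code e₂.code)

end

end WMLO

namespace WMLO

open MeasureTheory ProbabilityTheory

namespace PODTMC

variable {k : ℕ} (M : PODTMC k)

instance : IsProbabilityMeasure M.seqMeasure := by
  unfold seqMeasure
  infer_instance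

theorem seqMeasure_zero (s : Fin M.numStates) :
    M.seqMeasure {ω | ω 0 = s} = ENNReal.ofReal ((M.PI s : ℚ) : ℝ) := by
  have h : M.seqMeasure.map (fun ω => ω 0) = M.initPMF.toMeasure := by
    have h1 : M.seqMeasure.map (Preorder.frestrictLe (π := fun _ => Fin M.numStates) 0) =
        M.initPMF.toMeasure.map (MeasurableEquiv.piUnique
          (fun _ : Finset.Iic 0 => Fin M.numStates)).symm := by
      unfold seqMeasure Kernel.trajMeasure
      rw [Measure.map_comp _ _ (by fun_prop), Kernel.traj_map_frestrictLe,
        Kernel.partialTraj_self, Measure.id_comp]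
    have h2 := congrArg (Measure.map (fun h : (Finset.Iic 0 → Fin M.numStates) =>
      h ⟨0, Finset.mem_Iic.2 le_rfl⟩)) h1
    rw [Measure.map_map (by fun_prop) (by fun_prop),
      Measure.map_map (by fun_prop) (by fun_prop)] at h2
    refine h2.trans ?_
    exact Measure.map_id
  have h3 := congrArg (fun μ : Measure (Fin M.numStates) => μ {s}) h
  beta_reduce at h3
  rw [Measure.map_apply (by fun_prop) (by measurability),
    PMF.toMeasure_apply_singleton _ _ (by measurability)] at h3
  exact h3

/-- The probability that the chain follows a given finite sequence of states. -/
theorem seqMeasure_cylinder (ρ : ℕ → Fin M.numStates) (m : ℕ) :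
    M.seqMeasure {ω | ∀ j ≤ m, ω j = ρ j} =
      ENNReal.ofReal (((M.PI (ρ 0) * ∏ j ∈ Finset.range m, M.PT (ρ j) (ρ (j + 1)) : ℚ)) : ℝ) := by
  induction m with
  | zero =>
    simpa using M.seqMeasure_zero (ρ 0)
  | succ m ih =>
    have h := Kernel.map_frestrictLe_trajMeasure_compProd_eq_map_trajMeasure
      (X := fun _ => Fin M.numStates) (μ₀ := M.initPMF.toMeasure) (κ := M.histKernel) (a := m)
    set S : Set (Finset.Iic m → Fin M.numStates) :=
      {(fun j => ρ j : Finset.Iic m → Fin M.numStates)} with hS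
    have hSm : MeasurableSet S := MeasurableSet.of_discrete
    have h2 := congrArg (fun μ : Measure ((Finset.Iic m → Fin M.numStates) × Fin M.numStates) =>
      μ (S ×ˢ {ρ (m + 1)})) h
    beta_reduce at h2
    rw [Measure.compProd_apply_prod hSm (by measurability),
      Measure.map_apply (by fun_prop) (by measurability)] at h2
    have e1 : (fun x : ℕ → Fin M.numStates =>
        (Preorder.frestrictLe (π := fun _ => Fin M.numStates) m x, x (m + 1))) ⁻¹'
          (S ×ˢ {ρ (m + 1)}) = {ω | ∀ j ≤ m + 1, ω j = ρ j} := by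
      ext ω
      simp only [hS, Set.mem_preimage, Set.mem_prod, Set.mem_singleton_iff, Set.mem_ofPred_eq]
      constructor
      · rintro ⟨h1, h2⟩ j hj
        rcases Nat.lt_or_ge m j with h3 | h3
        · obtain rfl : j = m + 1 := by omega
          exact h2
        · exact congrFun h1 ⟨j, Finset.mem_Iic.2 h3⟩
      · intro h1
        refine ⟨?_, h1 _ le_rfl⟩
        funext j
        exact h1 j ((Finset.mem_Iic.1 j.2).trans (Nat.le_succ m))
    have e2 : (Preorder.frestrictLe (π := fun _ => Fin M.numStates) m) ⁻¹' S =
        {ω | ∀ j ≤ m, ω j = ρ j} := by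
      ext ω
      simp only [hS, Set.mem_preimage, Set.mem_singleton_iff, Set.mem_ofPred_eq]
      constructor
      · intro h1 j hj
        exact congrFun h1 ⟨j, Finset.mem_Iic.2 hj⟩
      · intro h1
        funext j
        exact h1 j (Finset.mem_Iic.1 j.2)
    rw [e1] at h2
    change _ = M.seqMeasure _ at h2
    rw [← h2, hS, lintegral_singleton, Measure.map_apply (by fun_prop) (by measurability), ← hS, e2]
    change _ * M.seqMeasure _ = _
    rw [ih]
    have e3 : M.histKernel m (fun j => ρ j) {ρ (m + 1)} =
        ENNReal.ofReal ((M.PT (ρ m) (ρ (m + 1)) : ℚ) : ℝ) := by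
      change (M.stepPMF (ρ m)).toMeasure {ρ (m + 1)} = _
      rw [PMF.toMeasure_apply_singleton _ _ (by measurability)]
      rfl
    rw [e3, ← ENNReal.ofReal_mul (by exact_mod_cast M.PT_nonneg _ _), Finset.prod_range_succ]
    congr 1
    push_cast
    ring

theorem measurableSet_path :
    MeasurableSet {ρ : ℕ → Fin M.numStates |
      M.PI (ρ 0) ≠ 0 ∧ ∀ m, 0 < M.PT (ρ m) (ρ (m + 1))} := by
  have h0 : MeasurableSet {ρ : ℕ → Fin M.numStates | M.PI (ρ 0) ≠ 0} :=
    measurableSet_preimage (f := fun ρ : ℕ → Fin M.numStates => ρ 0) (measurable_pi_apply 0)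
      (MeasurableSet.of_discrete (s := {s | M.PI s ≠ 0}))
  have h1 : ∀ m, MeasurableSet {ρ : ℕ → Fin M.numStates | 0 < M.PT (ρ m) (ρ (m + 1))} := fun m =>
    measurableSet_preimage (f := fun ρ : ℕ → Fin M.numStates => (ρ m, ρ (m + 1)))
      ((measurable_pi_apply m).prodMk (measurable_pi_apply (m + 1)))
      (MeasurableSet.of_discrete (s := {p : Fin M.numStates × Fin M.numStates | 0 < M.PT p.1 p.2}))
  rw [Set.ofPred_and, Set.ofPred_forall]
  exact h0.inter (MeasurableSet.iInter h1)

/-- Almost every sequence of states is a path. -/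
theorem ae_path : ∀ᵐ ρ ∂M.seqMeasure,
    M.PI (ρ 0) ≠ 0 ∧ ∀ m, 0 < M.PT (ρ m) (ρ (m + 1)) := by
  have key : ∀ (m : ℕ) (f : (Finset.Iic (m + 1) → Fin M.numStates)),
      ∀ᵐ ω ∂M.seqMeasure, (∀ j : Finset.Iic (m + 1), ω j = f j) →
        M.PI (ω 0) ≠ 0 ∧ 0 < M.PT (ω m) (ω (m + 1)) := by
    intro m f
    by_cases hf : M.PI (f ⟨0, by simp⟩) ≠ 0 ∧ 0 < M.PT (f ⟨m, by simp⟩) (f ⟨m + 1, by simp⟩)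
    · refine Filter.Eventually.of_forall fun ω hω => ?_
      rw [← hω, ← hω, ← hω] at hf
      exact hf
    · set ρ : ℕ → Fin M.numStates := fun j =>
        if hj : j ≤ m + 1 then f ⟨j, Finset.mem_Iic.2 hj⟩ else f ⟨0, by simp⟩ with hρ
      have hz : M.PI (ρ 0) * ∏ j ∈ Finset.range (m + 1), M.PT (ρ j) (ρ (j + 1)) = 0 := by
        have r0 : ρ 0 = f ⟨0, by simp⟩ := by simp [hρ]
        have r1 : ρ m = f ⟨m, by simp⟩ := by simp [hρ]
        have r2 : ρ (m + 1) = f ⟨m + 1, by simp⟩ := by simp [hρ]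
        rw [← r0, ← r1, ← r2, not_and_or] at hf
        rcases hf with hf | hf
        · rw [not_not.1 hf, zero_mul]
        · rw [Finset.prod_range_succ, le_antisymm (not_lt.1 hf) (M.PT_nonneg _ _), mul_zero,
            mul_zero]
      have hc := M.seqMeasure_cylinder ρ (m + 1)
      rw [hz] at hc
      simp only [Rat.cast_zero, ENNReal.ofReal_zero] at hc
      rw [ae_iff]
      refine measure_mono_null ?_ hc
      intro ω hω j hj
      simp only [Set.mem_ofPred_eq, Classical.not_imp] at hω
      rw [hω.1 ⟨j, Finset.mem_Iic.2 hj⟩]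
      simp [hρ, hj]
  have key2 : ∀ m : ℕ, ∀ᵐ ω ∂M.seqMeasure, M.PI (ω 0) ≠ 0 ∧ 0 < M.PT (ω m) (ω (m + 1)) := by
    intro m
    filter_upwards [ae_all_iff.2 (key m)] with ω hω
    exact hω (fun j => ω j) (fun _ => rfl)
  filter_upwards [ae_all_iff.2 key2] with ω hω
  exact ⟨(hω 0).1, fun m => (hω m).2⟩

theorem pathMeasure_apply (A : Set (ℕ → Fin M.numStates)) :
    M.pathMeasure {ρ | ρ.1 ∈ A} = M.seqMeasure A := by
  unfold pathMeasure
  have e : MeasurableEmbedding (Subtype.val : M.Path → ℕ → Fin M.numStates) :=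
    MeasurableEmbedding.subtype_coe M.measurableSet_path
  rw [e.comap_apply]
  refine measure_congr ?_
  filter_upwards [M.ae_path] with ρ hρ
  apply propext
  constructor
  · rintro ⟨ω, hω, rfl⟩
    exact hω
  · intro h
    exact ⟨⟨ρ, hρ⟩, h, rfl⟩

instance : IsProbabilityMeasure M.pathMeasure :=
  ⟨by simpa using M.pathMeasure_apply Set.univ⟩

/-- The probability of the set of paths with a given finite prefix. -/
theorem pathMeasure_cylinder (ρ : M.Path) (m : ℕ) :
    M.pathMeasure {ω | ∀ j ≤ m, ω.1 j = ρ.1 j} =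
      ENNReal.ofReal
        (((M.PI (ρ.1 0) * ∏ j ∈ Finset.range m, M.PT (ρ.1 j) (ρ.1 (j + 1)) : ℚ)) : ℝ) :=
  (M.pathMeasure_apply {ω | ∀ j ≤ m, ω j = ρ.1 j}).trans (M.seqMeasure_cylinder ρ.1 m)

end PODTMC

theorem ratCode_injective : Function.Injective ratCode := by
  intro p q h
  simp only [ratCode, Nat.pair_eq_pair, Encodable.encode_inj] at h
  exact Rat.ext h.1 h.2

theorem Cmp.code_injective : Function.Injective Cmp.code := by
  intro a b h
  cases a <;> cases b <;> simp_all [Cmp.code]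

/-- A chain is determined by its code. -/
theorem PODTMC.code_injective {k : ℕ} : Function.Injective (PODTMC.code (k := k)) := by
  rintro ⟨n, PI, h1, h2, PT, h3, h4, O, I⟩ ⟨n', PI', h1', h2', PT', h3', h4', O', I'⟩ h
  simp only [PODTMC.code, Prod.mk.injEq] at h
  obtain ⟨rfl, hPI, hPT, hO, hI⟩ := h
  rw [List.ofFn_inj] at hPI hPT hO hI
  have e1 : PI = PI' := funext fun s => ratCode_injective (congrFun hPI s)
  have e2 : PT = PT' := funext fun s => funext fun t => by
    have := congrFun hPT s
    rw [List.ofFn_inj] at this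
    exact ratCode_injective (congrFun this t)
  have e3 : O = O' := funext fun i => by
    have := congrFun hO i
    rwa [List.ofFn_inj] at this
  have e4 : I = I' := funext fun s => by
    have := congrArg List.toFinset (congrFun hI s)
    simpa using this
  subst e1 e2 e3 e4
  rfl

mutual

/-- A formula is determined by its code. -/
theorem Formula.code_inj {k : ℕ} : ∀ φ ψ : Formula k, φ.code = ψ.code → φ = ψ
  | .prop _ _, ψ, h => by
    cases ψ <;> simp_all [Formula.code, Nat.pair_eq_pair]
  | .mem _ _, ψ, h => by
    cases ψ <;> simp_all [Formula.code, Nat.pair_eq_pair]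
  | .lt _ _, ψ, h => by
    cases ψ <;> simp_all [Formula.code, Nat.pair_eq_pair]
  | .cmp e r c, ψ, h => by
    cases ψ with
    | cmp e' r' c' =>
      simp only [Formula.code, Nat.pair_eq_pair, true_and] at h
      rw [PExpr.code_inj e e' h.1, Cmp.code_injective h.2.1, ratCode_injective h.2.2]
    | _ => simp [Formula.code, Nat.pair_eq_pair] at h
  | .neg φ, ψ, h => by
    cases ψ with
    | neg φ' =>
      simp only [Formula.code, Nat.pair_eq_pair, true_and] at h
      rw [Formula.code_inj φ φ' h]
    | _ => simp [Formula.code, Nat.pair_eq_pair] at h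
  | .and φ χ, ψ, h => by
    cases ψ with
    | and φ' χ' =>
      simp only [Formula.code, Nat.pair_eq_pair, true_and] at h
      rw [Formula.code_inj φ φ' h.1, Formula.code_inj χ χ' h.2]
    | _ => simp [Formula.code, Nat.pair_eq_pair] at h
  | .know i t φ, ψ, h => by
    cases ψ with
    | know i' t' φ' =>
      simp only [Formula.code, Nat.pair_eq_pair, true_and] at h
      rw [Fin.ext h.1, h.2.1, Formula.code_inj φ φ' h.2.2]
    | _ => simp [Formula.code, Nat.pair_eq_pair] at h
  | .allTime t φ, ψ, h => by
    cases ψ with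
    | allTime t' φ' =>
      simp only [Formula.code, Nat.pair_eq_pair, true_and] at h
      rw [h.1, Formula.code_inj φ φ' h.2]
    | _ => simp [Formula.code, Nat.pair_eq_pair] at h
  | .allSet X φ, ψ, h => by
    cases ψ with
    | allSet X' φ' =>
      simp only [Formula.code, Nat.pair_eq_pair, true_and] at h
      rw [h.1, Formula.code_inj φ φ' h.2]
    | _ => simp [Formula.code, Nat.pair_eq_pair] at h

/-- A probability expression is determined by its code. -/
theorem PExpr.code_inj {k : ℕ} : ∀ e f : PExpr k, e.code = f.code → e = f
  | .const p, f, h => by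
    cases f with
    | const q =>
      simp only [PExpr.code, Nat.pair_eq_pair, true_and] at h
      rw [ratCode_injective h]
    | _ => simp [PExpr.code, Nat.pair_eq_pair] at h
  | .pr φ, f, h => by
    cases f with
    | pr φ' =>
      simp only [PExpr.code, Nat.pair_eq_pair, true_and] at h
      rw [Formula.code_inj φ φ' h]
    | _ => simp [PExpr.code, Nat.pair_eq_pair] at h
  | .prAgent i t φ, f, h => by
    cases f with
    | prAgent i' t' φ' =>
      simp only [PExpr.code, Nat.pair_eq_pair, true_and] at h
      rw [Fin.ext h.1, h.2.1, Formula.code_inj φ φ' h.2.2]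
    | _ => simp [PExpr.code, Nat.pair_eq_pair] at h
  | .add a b, f, h => by
    cases f with
    | add a' b' =>
      simp only [PExpr.code, Nat.pair_eq_pair, true_and] at h
      rw [PExpr.code_inj a a' h.1, PExpr.code_inj b b' h.2]
    | _ => simp [PExpr.code, Nat.pair_eq_pair] at h
  | .mul a b, f, h => by
    cases f with
    | mul a' b' =>
      simp only [PExpr.code, Nat.pair_eq_pair, true_and] at h
      rw [PExpr.code_inj a a' h.1, PExpr.code_inj b b' h.2]
    | _ => simp [PExpr.code, Nat.pair_eq_pair] at h

end

end WMLO

/-!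
On a chain with independent coin tosses, the probability that all tosses at the times of a finite
set `X` show heads is `q ^ |X|`. Hence, with `X` and `t` quantified from outside, the comparison
`Pr(∀ z ∈ X, heads at z) = Pr(∀ z < t, heads at z)` says `|X| = t`. Cardinality turns the order on
`ℕ` into full arithmetic, and finite sets of coded pairs are computation histories, so the graph of
every partial recursive function is definable by a formula that holds on all runs or on none. The
numeral `n` is the formula `Pr(∀ z < t, heads at z) = q ^ n`, with which the halting problem reduces
to model checking on one fixed chain.
-/

namespace WMLO

open MeasureTheory ProbabilityTheory

/-! ### Chains with independent tosses -/

namespace PODTMC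

variable {k : ℕ}

/-- The Bernoulli chains: at every time the atomic proposition `p` holds with probability `q`,
independently of all other times. It suffices to prescribe the probability that `p` holds throughout
a finite set of times. -/
def IsBernoulli (M : PODTMC k) (p : ℕ) (q : ℚ) : Prop :=
  ∀ U : Finset ℕ, M.pathMeasure.real {ρ | ∀ t ∈ U, p ∈ M.interp (ρ.1 t)} = (q : ℝ) ^ U.card

variable {M : PODTMC k}

theorem histKernel_eq_const (h : ∀ s t, M.PT s t = M.PI t) :
    M.histKernel = fun _ => Kernel.const _ M.initPMF.toMeasure := by
  funext m
  ext1 ω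
  have hstep : M.stepPMF (ω ⟨m, Finset.mem_Iic.2 le_rfl⟩) = M.initPMF := by
    ext t
    simp only [stepPMF, initPMF, PMF.ofFintype_apply, h]
  exact congrArg PMF.toMeasure hstep

theorem seqMeasure_eq_infinitePi (h : ∀ s t, M.PT s t = M.PI t) :
    M.seqMeasure = Measure.infinitePi fun _ => M.initPMF.toMeasure := by
  have hinit : M.initPMF.toMeasure.map (MeasurableEquiv.piUnique
      (fun _ : Finset.Iic 0 => Fin M.numStates)).symm =
        Measure.pi fun _ : Finset.Iic 0 => M.initPMF.toMeasure :=
    (measurePreserving_piUnique fun _ : Finset.Iic 0 => M.initPMF.toMeasure).symm.map_eq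
  have hnat : M.seqMeasure = Measure.infinitePiNat fun _ => M.initPMF.toMeasure := by
    simp only [seqMeasure, Kernel.trajMeasure, Measure.infinitePiNat, hinit,
      histKernel_eq_const h]
  rw [hnat]
  exact (Measure.isProjectiveLimit_infinitePiNat _).unique (Measure.isProjectiveLimit_infinitePi _)

theorem initPMF_toMeasure_real (A : Finset (Fin M.numStates)) :
    M.initPMF.toMeasure.real A = ((∑ s ∈ A, M.PI s : ℚ) : ℝ) := by
  have hs (s) : ENNReal.toReal (M.initPMF s) = ((M.PI s : ℚ) : ℝ) :=
    ENNReal.toReal_ofReal (by exact_mod_cast M.PI_nonneg s)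
  simp only [measureReal_def, PMF.toMeasure_apply_finset,
    ENNReal.toReal_sum fun s _ => M.initPMF.apply_ne_top s, hs, Rat.cast_sum]

theorem isBernoulli_of_iid (h : ∀ s t, M.PT s t = M.PI t) (p : ℕ) :
    M.IsBernoulli p (∑ s with p ∈ M.interp s, M.PI s) := by
  intro U
  have hpi := Measure.infinitePi_pi (fun _ : ℕ => M.initPMF.toMeasure) (s := U)
    (t := fun _ => {s | p ∈ M.interp s}) fun _ _ => .of_discrete
  rw [← seqMeasure_eq_infinitePi h, ← pathMeasure_apply, Finset.prod_const] at hpi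
  have hfin : {s | p ∈ M.interp s} = ↑({s | p ∈ M.interp s} : Finset (Fin M.numStates)) := by simp
  rw [← initPMF_toMeasure_real, ← hfin, measureReal_def, measureReal_def, ← ENNReal.toReal_pow,
    ← hpi]
  rfl

end PODTMC

/-- Independent tosses of a fair coin; the atomic proposition `0` marks heads, the state `1`. -/
def coin (k : ℕ) : PODTMC k where
  numStates := 2
  PI _ := 1 / 2
  PI_nonneg _ := by norm_num
  PI_sum := by norm_num
  PT _ _ := 1 / 2
  PT_nonneg _ _ := by norm_num
  PT_sum _ := by norm_num
  obs _ _ := 0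
  interp s := if s = 1 then {0} else ∅

theorem coin_isBernoulli (k : ℕ) : (coin k).IsBernoulli 0 (1 / 2) := by
  have h := PODTMC.isBernoulli_of_iid (M := coin k) (fun _ _ => rfl) 0
  have hsum : ∑ s with 0 ∈ (coin k).interp s, (coin k).PI s = 1 / 2 := by
    rw [Finset.sum_filter]
    exact (Fin.sum_univ_two _).trans (by simp [coin])
  rwa [hsum] at h

/-! ### Formulas expressing cardinalities -/

namespace Assignment

variable (τ : Assignment)

@[simp]
theorem time_updTime (t n : ℕ) : (τ.updTime t n).time = Function.update τ.time t n := rfl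

@[simp]
theorem set_updTime (t n : ℕ) : (τ.updTime t n).set = τ.set := rfl

@[simp]
theorem time_updSet (X : ℕ) (U : Finset ℕ) : (τ.updSet X U).time = τ.time := rfl

@[simp]
theorem set_updSet (X : ℕ) (U : Finset ℕ) : (τ.updSet X U).set = Function.update τ.set X U := rfl

end Assignment

namespace Formula

variable {k : ℕ}

/-- The implication `φ → ψ`, a derived connective. -/
def imp (φ ψ : Formula k) : Formula k := .neg (.and φ (.neg ψ))

@[simp]
theorem sat_imp {M : PODTMC k} {x : Recall} {φ ψ : Formula k} {τ : Assignment} {ρ : M.Path} :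
    (φ.imp ψ).Sat M x τ ρ ↔ (φ.Sat M x τ ρ → ψ.Sat M x τ ρ) := by
  simp [imp, Sat]

/-- The formula `∀ z, φ → p(z)`: all tosses at the times `z` described by `φ` show heads. -/
def allHeads (p z : ℕ) (φ : Formula k) : Formula k := .allTime z (φ.imp (.prop p z))

/-- The formula `|X| = t`, expressed by `Pr(∀ z ∈ X, p(z)) - Pr(∀ z < t, p(z)) = 0`. -/
def cardEq (p z X t : ℕ) : Formula k :=
  .cmp (.add (.pr (allHeads p z (.mem X z)))
    (.mul (.const (-1)) (.pr (allHeads p z (.lt z t))))) .eq 0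

/-- The formula `t = n` for a number `n`, expressed by `Pr(∀ z < t, p(z)) = q ^ n`. -/
def eqNumeral (p : ℕ) (q : ℚ) (z t n : ℕ) : Formula k :=
  .cmp (.pr (allHeads p z (.lt z t))) .eq (q ^ n)

end Formula

namespace PODTMC.IsBernoulli

variable {k : ℕ} {M : PODTMC k} {x : Recall} {p : ℕ} {q : ℚ} {z t : ℕ} {τ : Assignment}

theorem val_pr_allHeads (hM : M.IsBernoulli p q) {φ : Formula k} {U : Finset ℕ}
    (hφ : ∀ n ρ, φ.Sat M x (τ.updTime z n) ρ ↔ n ∈ U) (ρ : M.Path) :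
    (PExpr.pr (φ.allHeads p z)).val M x τ ρ = (q : ℝ) ^ U.card := by
  simp [PExpr.val, Formula.allHeads, Formula.Sat, hφ, ← hM U]

theorem val_pr_allHeads_mem (hM : M.IsBernoulli p q) (X : ℕ) (ρ : M.Path) :
    (PExpr.pr (.allHeads p z (.mem X z))).val M x τ ρ = (q : ℝ) ^ (τ.set X).card :=
  hM.val_pr_allHeads (fun n _ => by simp [Formula.Sat]) ρ

theorem val_pr_allHeads_lt (hM : M.IsBernoulli p q) (htz : t ≠ z) (ρ : M.Path) :
    (PExpr.pr (.allHeads p z (.lt z t))).val M x τ ρ = (q : ℝ) ^ τ.time t := by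
  simpa using hM.val_pr_allHeads (U := Finset.range (τ.time t))
    (fun n _ => by simp [Formula.Sat, Function.update_of_ne htz]) ρ

theorem sat_cardEq (hM : M.IsBernoulli p q) (h0 : 0 < q) (h1 : q < 1) (htz : t ≠ z) (X : ℕ)
    (ρ : M.Path) : (Formula.cardEq p z X t).Sat M x τ ρ ↔ (τ.set X).card = τ.time t := by
  rw [← pow_right_inj₀ (a := (q : ℝ)) (by exact_mod_cast h0) (by exact_mod_cast h1.ne)]
  change (PExpr.pr _).val M x τ ρ + ((-1 : ℚ) : ℝ) * (PExpr.pr _).val M x τ ρ = ((0 : ℚ) : ℝ) ↔ _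
  rw [hM.val_pr_allHeads_mem, hM.val_pr_allHeads_lt htz, Rat.cast_neg, Rat.cast_one, neg_one_mul,
    Rat.cast_zero, add_neg_eq_zero]

theorem sat_eqNumeral (hM : M.IsBernoulli p q) (h0 : 0 < q) (h1 : q < 1) (htz : t ≠ z) (n : ℕ)
    (ρ : M.Path) : (Formula.eqNumeral p q z t n).Sat M x τ ρ ↔ τ.time t = n := by
  rw [← pow_right_inj₀ (a := (q : ℝ)) (by exact_mod_cast h0) (by exact_mod_cast h1.ne)]
  simp only [Formula.eqNumeral, Formula.Sat, hM.val_pr_allHeads_lt htz, Cmp.Holds, Rat.cast_pow]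

end PODTMC.IsBernoulli

/-! ### Definable relations -/

/-- The formula `φ` of the fragment defines the relation `P` on the chain `M`, where the arguments
of `P` are the values of the time variables `v` and of the set variables `w`, and no other variable
is free in `φ`. The truth value does not depend on the run. -/
structure Formula.Defines {k n m : ℕ} (φ : Formula k) (M : PODTMC k) (x : Recall) (v : Fin n → ℕ)
    (w : Fin m → ℕ) (P : (Fin n → ℕ) → (Fin m → Finset ℕ) → Prop) : Prop where
  linearGlobal : φ.LinearGlobal
  freeTime_subset : (φ.freeTime : Set ℕ) ⊆ Set.range v
  freeSet_subset : (φ.freeSet : Set ℕ) ⊆ Set.range w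
  sat_iff : ∀ τ ρ, φ.Sat M x τ ρ ↔ P (fun i => τ.time (v i)) (fun j => τ.set (w j))

/-- A relation between `n` natural numbers and `m` finite sets is definable on `M` if every choice
of variables, possibly with repetitions, admits a formula that defines it. -/
def Definable {k n m : ℕ} (M : PODTMC k) (x : Recall)
    (P : (Fin n → ℕ) → (Fin m → Finset ℕ) → Prop) : Prop :=
  ∀ (v : Fin n → ℕ) (w : Fin m → ℕ), ∃ φ : Formula k, φ.Defines M x v w P

theorem exists_forall_ne {n : ℕ} (v : Fin n → ℕ) : ∃ z, ∀ i, v i ≠ z := by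
  obtain ⟨z, hz⟩ := (Set.finite_range v).exists_notMem
  exact ⟨z, fun i hi => hz ⟨i, hi⟩⟩

namespace Definable

variable {k n m : ℕ} {M : PODTMC k} {x : Recall}
  {P Q : (Fin n → ℕ) → (Fin m → Finset ℕ) → Prop}

theorem of_iff (hP : Definable M x P) (h : ∀ a s, Q a s ↔ P a s) : Definable M x Q :=
  (funext₂ fun a s => propext (h a s) : Q = P) ▸ hP

theorem reindex (hP : Definable M x P) {n' m' : ℕ} (f : Fin n → Fin n') (g : Fin m → Fin m') :
    Definable M x fun (a : Fin n' → ℕ) (s : Fin m' → Finset ℕ) =>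
      P (fun i => a (f i)) (fun j => s (g j)) := fun v w =>
  let ⟨φ, hφ⟩ := hP (v ∘ f) (w ∘ g)
  ⟨φ, hφ.linearGlobal, hφ.freeTime_subset.trans (Set.range_comp_subset_range f v),
    hφ.freeSet_subset.trans (Set.range_comp_subset_range g w), hφ.sat_iff⟩

theorem mem (i : Fin n) (j : Fin m) : Definable M x fun a s => a i ∈ s j := fun v w =>
  ⟨.mem (w j) (v i), trivial, by simp [Formula.freeTime], by simp [Formula.freeSet],
    fun _ _ => by simp [Formula.Sat]⟩

theorem lt (i j : Fin n) : Definable M x fun a (_ : Fin m → Finset ℕ) => a i < a j := fun v _ =>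
  ⟨.lt (v i) (v j), trivial, by simp [Formula.freeTime, Set.insert_subset_iff],
    by simp [Formula.freeSet], fun _ _ => by simp [Formula.Sat]⟩

theorem not (hP : Definable M x P) : Definable M x fun a s => ¬ P a s := fun v w =>
  let ⟨φ, hφ⟩ := hP v w
  ⟨.neg φ, hφ.linearGlobal, hφ.freeTime_subset, hφ.freeSet_subset,
    fun τ ρ => by simp [Formula.Sat, hφ.sat_iff]⟩

theorem and (hP : Definable M x P) (hQ : Definable M x Q) :
    Definable M x fun a s => P a s ∧ Q a s := fun v w =>
  let ⟨φ, hφ⟩ := hP v w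
  let ⟨ψ, hψ⟩ := hQ v w
  ⟨.and φ ψ, ⟨hφ.linearGlobal, hψ.linearGlobal⟩,
    by simpa [Formula.freeTime] using ⟨hφ.freeTime_subset, hψ.freeTime_subset⟩,
    by simpa [Formula.freeSet] using ⟨hφ.freeSet_subset, hψ.freeSet_subset⟩,
    fun τ ρ => by simp [Formula.Sat, hφ.sat_iff, hψ.sat_iff]⟩

theorem or (hP : Definable M x P) (hQ : Definable M x Q) :
    Definable M x fun a s => P a s ∨ Q a s :=
  (hP.not.and hQ.not).not.of_iff fun _ _ => by tauto

theorem imp (hP : Definable M x P) (hQ : Definable M x Q) :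
    Definable M x fun a s => P a s → Q a s :=
  (hP.and hQ.not).not.of_iff fun _ _ => by tauto

theorem iff (hP : Definable M x P) (hQ : Definable M x Q) :
    Definable M x fun a s => (P a s ↔ Q a s) :=
  ((hP.imp hQ).and (hQ.imp hP)).of_iff fun _ _ => iff_iff_implies_and_implies

theorem allTime {P : (Fin n → ℕ) → (Fin m → Finset ℕ) → ℕ → Prop}
    (hP : Definable M x fun (a : Fin (n + 1) → ℕ) s => P (fun i => a i.succ) s (a 0)) :
    Definable M x fun a s => ∀ y, P a s y := fun v w => by
  obtain ⟨z, hz⟩ := exists_forall_ne v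
  obtain ⟨φ, hφ⟩ := hP (Fin.cons z v) w
  refine ⟨.allTime z φ, hφ.linearGlobal, ?_, hφ.freeSet_subset, fun τ ρ => ?_⟩
  · simpa [Formula.freeTime, Fin.range_cons] using hφ.freeTime_subset
  · simp [Formula.Sat, hφ.sat_iff, Function.update_of_ne (hz _)]

theorem allSet {P : (Fin n → ℕ) → (Fin m → Finset ℕ) → Finset ℕ → Prop}
    (hP : Definable M x fun a (s : Fin (m + 1) → Finset ℕ) => P a (fun j => s j.succ) (s 0)) :
    Definable M x fun a s => ∀ U, P a s U := fun v w => by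
  obtain ⟨z, hz⟩ := exists_forall_ne w
  obtain ⟨φ, hφ⟩ := hP v (Fin.cons z w)
  refine ⟨.allSet z φ, hφ.linearGlobal, hφ.freeTime_subset, ?_, fun τ ρ => ?_⟩
  · simpa [Formula.freeSet, Fin.range_cons] using hφ.freeSet_subset
  · simp [Formula.Sat, hφ.sat_iff, Function.update_of_ne (hz _)]

theorem exTime {P : (Fin n → ℕ) → (Fin m → Finset ℕ) → ℕ → Prop}
    (hP : Definable M x fun (a : Fin (n + 1) → ℕ) s => P (fun i => a i.succ) s (a 0)) :
    Definable M x fun a s => ∃ y, P a s y :=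
  (allTime (P := fun a s y => ¬ P a s y) hP.not).not.of_iff fun _ _ => by simp

theorem exSet {P : (Fin n → ℕ) → (Fin m → Finset ℕ) → Finset ℕ → Prop}
    (hP : Definable M x fun a (s : Fin (m + 1) → Finset ℕ) => P a (fun j => s j.succ) (s 0)) :
    Definable M x fun a s => ∃ U, P a s U :=
  (allSet (P := fun a s U => ¬ P a s U) hP.not).not.of_iff fun _ _ => by simp

theorem eq_zero (i : Fin n) : Definable M x fun a (_ : Fin m → Finset ℕ) => a i = 0 :=
  (allTime (P := fun a _ y => ¬ y < a i) (lt 0 i.succ).not).of_iff fun a _ =>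
    ⟨fun h => by simp [h], fun h => by simpa using h 0⟩

theorem eq_succ (i j : Fin n) : Definable M x fun a (_ : Fin m → Finset ℕ) => a j = a i + 1 := by
  refine Definable.of_iff (P := fun a _ => ∀ y, y < a j ↔ ¬ a i < y)
    (.allTime (.iff (.lt _ _) (.not (.lt _ _)))) fun a _ => ⟨fun h y => by omega, fun h => ?_⟩
  have hi := h (a i)
  have hsucc := h (a i + 1)
  omega

end Definable

/-- Cardinality is definable on the chain `M`: the formulas of the fragment can say that a finite
set has a given number of elements. -/
def DefinesCard {k : ℕ} (M : PODTMC k) (x : Recall) : Prop :=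
  Definable M x fun (a : Fin 1 → ℕ) (s : Fin 1 → Finset ℕ) => (s 0).card = a 0

theorem PODTMC.IsBernoulli.definesCard {k : ℕ} {M : PODTMC k} {x : Recall} {p : ℕ} {q : ℚ}
    (hM : M.IsBernoulli p q) (h0 : 0 < q) (h1 : q < 1) : DefinesCard M x := fun v w => by
  obtain ⟨z, hz⟩ := exists_forall_ne v
  exact ⟨.cardEq p z (w 0) (v 0),
    by simp [Formula.cardEq, Formula.allHeads, Formula.imp, Formula.LinearGlobal,
      PExpr.LinearGlobal],
    by simp [Formula.cardEq, Formula.allHeads, Formula.imp, Formula.freeTime, PExpr.freeTime,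
      Set.insert_subset_iff],
    by simp [Formula.cardEq, Formula.allHeads, Formula.imp, Formula.freeSet, PExpr.freeSet],
    fun τ ρ => hM.sat_cardEq h0 h1 (hz 0) (w 0) ρ⟩

/-! ### Arithmetic from cardinality -/

theorem eq_add_iff_exists_card {a b c : ℕ} :
    c = a + b ↔ ¬ c < a ∧ ∃ U : Finset ℕ, (∀ y, y ∈ U ↔ ¬ y < a ∧ y < c) ∧ U.card = b := by
  have hU (U : Finset ℕ) : (∀ y, y ∈ U ↔ ¬ y < a ∧ y < c) ↔ U = Finset.Ico a c := by
    simp [Finset.ext_iff]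
  simp only [hU, exists_eq_left, Nat.card_Ico]
  omega

theorem dvd_iff_exists_finset {a b : ℕ} :
    a ∣ b ↔ ∃ U : Finset ℕ, b ∈ U ∧ ∀ u ∈ U, u = 0 ∨ ∃ r ∈ U, r < u ∧ u = r + a := by
  constructor
  · rintro ⟨q, rfl⟩
    rcases a.eq_zero_or_pos with rfl | ha
    · exact ⟨{0}, by simp⟩
    · refine ⟨(Finset.range (q + 1)).image (a * ·), Finset.mem_image_of_mem _ (by simp), ?_⟩
      simp only [Finset.forall_mem_image, Finset.mem_range]
      rintro (_ | c) hc
      · exact .inl (mul_zero a)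
      · exact .inr ⟨a * c, Finset.mem_image_of_mem _ (by simp; omega), by rw [mul_add]; omega,
          by ring⟩
  · rintro ⟨U, hb, hU⟩
    suffices ∀ u ∈ U, a ∣ u from this b hb
    intro u
    induction u using Nat.strong_induction_on with
    | _ u ih =>
      intro hu
      rcases hU u hu with rfl | ⟨r, hr, hru, rfl⟩
      · exact dvd_zero a
      · exact (ih r hru hr).add (dvd_refl a)

theorem eq_mul_iff_exists_card {a b c : ℕ} :
    c = a * b ↔ (a = 0 ∧ c = 0) ∨ ¬ a = 0 ∧ a ∣ c ∧
      ∃ U : Finset ℕ, (∀ y, y ∈ U ↔ ¬ y = 0 ∧ ¬ c < y ∧ a ∣ y) ∧ U.card = b := by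
  rcases a.eq_zero_or_pos with rfl | ha
  · simp
  have hU (U : Finset ℕ) : (∀ y, y ∈ U ↔ ¬ y = 0 ∧ ¬ c < y ∧ a ∣ y) ↔
      U = {y ∈ Finset.Ioc 0 c | a ∣ y} := by
    simp [Finset.ext_iff, Nat.pos_iff_ne_zero, and_assoc]
  simp only [ha.ne', false_and, false_or, not_false_eq_true, true_and, hU, exists_eq_left,
    Nat.Ioc_filter_dvd_card_eq_div]
  exact ⟨fun h => ⟨⟨b, h⟩, (Nat.div_eq_iff_eq_mul_right ha ⟨b, h⟩).2 h⟩,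
    fun ⟨hac, h⟩ => (Nat.div_eq_iff_eq_mul_right ha hac).1 h⟩

namespace DefinesCard

variable {k n m : ℕ} {M : PODTMC k} {x : Recall}

theorem card_eq (hc : DefinesCard M x) (i : Fin n) (j : Fin m) :
    Definable M x fun a s => (s j).card = a i :=
  Definable.reindex hc (fun _ => i) (fun _ => j)

theorem eq_add (hc : DefinesCard M x) (i j l : Fin n) :
    Definable M x fun a (_ : Fin m → Finset ℕ) => a l = a i + a j :=
  .of_iff (.and (.not (.lt _ _)) (.exSet (.and
    (.allTime (.iff (.mem _ _) (.and (.not (.lt _ _)) (.lt _ _)))) (hc.card_eq _ _))))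
    fun _ _ => eq_add_iff_exists_card

theorem dvd (hc : DefinesCard M x) (i j : Fin n) :
    Definable M x fun a (_ : Fin m → Finset ℕ) => a i ∣ a j :=
  .of_iff (.exSet (.and (.mem _ _) (.allTime (.imp (.mem _ _) (.or (.eq_zero _)
    (.exTime (.and (.mem _ _) (.and (.lt _ _) (hc.eq_add _ _ _)))))))))
    fun _ _ => dvd_iff_exists_finset

theorem eq_mul (hc : DefinesCard M x) (i j l : Fin n) :
    Definable M x fun a (_ : Fin m → Finset ℕ) => a l = a i * a j :=
  .of_iff (.or (.and (.eq_zero _) (.eq_zero _)) (.and (.not (.eq_zero _)) (.and (hc.dvd _ _)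
    (.exSet (.and (.allTime (.iff (.mem _ _) (.and (.not (.eq_zero _)) (.and (.not (.lt _ _))
      (hc.dvd _ _))))) (hc.card_eq _ _))))))
    fun _ _ => eq_mul_iff_exists_card

theorem eq_pair (hc : DefinesCard M x) (i j l : Fin n) :
    Definable M x fun a (_ : Fin m → Finset ℕ) => a l = Nat.pair (a i) (a j) := by
  refine Definable.of_iff (P := fun a _ =>
    (a i < a j ∧ ∃ y, y = a j * a j ∧ a l = y + a i) ∨
      (¬ a i < a j ∧ ∃ y, y = a i * a i ∧ ∃ u, u = y + a i ∧ a l = u + a j)) ?_ fun a _ => ?_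
  · exact .or (.and (.lt _ _) (.exTime (.and (hc.eq_mul _ _ _) (hc.eq_add _ _ _))))
      (.and (.not (.lt _ _)) (.exTime (.and (hc.eq_mul _ _ _)
        (.exTime (.and (hc.eq_add _ _ _) (hc.eq_add _ _ _))))))
  · simp only [exists_eq_left, Nat.pair]
    split_ifs with h <;> simp [h]

end DefinesCard

/-! ### Partial recursive functions -/

/-- The graph of the partial function `f` is definable on the chain `M`. -/
def DefinableGraph {k : ℕ} (M : PODTMC k) (x : Recall) (f : ℕ →. ℕ) : Prop :=
  Definable M x fun (a : Fin 2 → ℕ) (_ : Fin 0 → Finset ℕ) => a 1 ∈ f (a 0)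

/-- The value `v` at the index `i` is justified in the recursion that starts with `f a` and
continues with `g`: it is the initial value, or one step of the recursion leads to it from a coded
pair of an index and a value in `U`. -/
def IsPrecStep (f g : ℕ →. ℕ) (a : ℕ) (U : Finset ℕ) (i v : ℕ) : Prop :=
  (i = 0 ∧ v ∈ f a) ∨ ∃ j w, i = j + 1 ∧ Nat.pair j w ∈ U ∧ v ∈ g (Nat.pair a (Nat.pair j w))

/-- A computation history of a primitive recursion: a finite set of coded pairs of an index and a
value, each of which is justified within the set. -/
def IsPrecTrace (f g : ℕ →. ℕ) (a : ℕ) (U : Finset ℕ) : Prop :=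
  ∀ i v, Nat.pair i v ∈ U → IsPrecStep f g a U i v

theorem IsPrecStep.mono {f g : ℕ →. ℕ} {a i v : ℕ} {U V : Finset ℕ} (h : IsPrecStep f g a U i v)
    (hUV : U ⊆ V) : IsPrecStep f g a V i v :=
  h.imp_right fun ⟨j, w, hi, hj, hv⟩ => ⟨j, w, hi, hUV hj, hv⟩

theorem IsPrecTrace.insert {f g : ℕ →. ℕ} {a i v : ℕ} {U : Finset ℕ} (hU : IsPrecTrace f g a U)
    (h : IsPrecStep f g a U i v) : IsPrecTrace f g a (insert (Nat.pair i v) U) := by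
  intro i' v' hiv
  refine IsPrecStep.mono ?_ (Finset.subset_insert _ U)
  rcases Finset.mem_insert.1 hiv with heq | hmem
  · obtain ⟨rfl, rfl⟩ := Nat.pair_eq_pair.1 heq
    exact h
  · exact hU i' v' hmem

theorem mem_prec_iff_exists_isPrecTrace {f g : ℕ →. ℕ} {a n y : ℕ} :
    y ∈ (n.rec (f a) fun i ih => do let v ← ih; g (Nat.pair a (Nat.pair i v)) : Part ℕ) ↔
      ∃ U, Nat.pair n y ∈ U ∧ IsPrecTrace f g a U := by
  constructor
  · intro h
    induction n generalizing y with
    | zero =>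
      have hempty : IsPrecTrace f g a ∅ := fun _ _ hiv => absurd hiv (Finset.notMem_empty _)
      exact ⟨_, Finset.mem_insert_self _ _, hempty.insert (.inl ⟨rfl, h⟩)⟩
    | succ n ih =>
      obtain ⟨w, hw, hy⟩ := Part.mem_bind_iff.1 h
      obtain ⟨U, hnw, hU⟩ := ih hw
      exact ⟨_, Finset.mem_insert_self _ _, hU.insert (.inr ⟨n, w, rfl, hnw, hy⟩)⟩
  · rintro ⟨U, hy, hU⟩
    induction n generalizing y with
    | zero =>
      rcases hU _ _ hy with ⟨-, hf⟩ | ⟨j, w, hj, -⟩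
      · exact hf
      · exact absurd hj.symm j.succ_ne_zero
    | succ n ih =>
      rcases hU _ _ hy with ⟨hn, -⟩ | ⟨j, w, hj, hw, hg⟩
      · exact absurd hn n.succ_ne_zero
      · obtain rfl : n = j := Nat.succ_injective hj
        exact Part.mem_bind_iff.2 ⟨w, ih hw, hg⟩

namespace DefinableGraph

variable {k n m : ℕ} {M : PODTMC k} {x : Recall} {f g : ℕ →. ℕ}

theorem mem (hf : DefinableGraph M x f) (i j : Fin n) :
    Definable M x fun a (_ : Fin m → Finset ℕ) => a j ∈ f (a i) :=
  Definable.reindex hf ![i, j] Fin.elim0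

theorem isPrecTrace (hc : DefinesCard M x) (hf : DefinableGraph M x f) (hg : DefinableGraph M x g)
    (i : Fin n) (j : Fin m) : Definable M x fun a s => IsPrecTrace f g (a i) (s j) := by
  refine Definable.of_iff (P := fun a s => ∀ i' v p, p = Nat.pair i' v → p ∈ s j →
    (i' = 0 ∧ v ∈ f (a i)) ∨ ∃ j' w r b, i' = j' + 1 ∧ r = Nat.pair j' w ∧ r ∈ s j ∧
      b = Nat.pair (a i) r ∧ v ∈ g b) ?_ fun a s => by simp [IsPrecTrace, IsPrecStep]
  exact .allTime (.allTime (.allTime (.imp (hc.eq_pair _ _ _) (.imp (.mem _ _)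
    (.or (.and (.eq_zero _) (hf.mem _ _)) (.exTime (.exTime (.exTime (.exTime
      (.and (.eq_succ _ _) (.and (hc.eq_pair _ _ _) (.and (.mem _ _)
        (.and (hc.eq_pair _ _ _) (hg.mem _ _))))))))))))))

theorem zero : DefinableGraph M x (pure 0) :=
  (Definable.eq_zero 1).of_iff fun _ _ => Part.mem_some_iff

theorem succ : DefinableGraph M x Nat.succ :=
  (Definable.eq_succ 0 1).of_iff fun _ _ => Part.mem_some_iff

theorem left (hc : DefinesCard M x) : DefinableGraph M x fun c => c.unpair.1 :=
  .of_iff (P := fun a _ => ∃ u, a 0 = Nat.pair (a 1) u) (.exTime (hc.eq_pair _ _ _))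
    fun a _ => Part.mem_some_iff.trans
      ⟨fun h => ⟨(a 0).unpair.2, by rw [h, Nat.pair_unpair]⟩, fun ⟨u, hu⟩ => by simp [hu]⟩

theorem right (hc : DefinesCard M x) : DefinableGraph M x fun c => c.unpair.2 :=
  .of_iff (P := fun a _ => ∃ u, a 0 = Nat.pair u (a 1)) (.exTime (hc.eq_pair _ _ _))
    fun a _ => Part.mem_some_iff.trans
      ⟨fun h => ⟨(a 0).unpair.1, by rw [h, Nat.pair_unpair]⟩, fun ⟨u, hu⟩ => by simp [hu]⟩

theorem pair (hc : DefinesCard M x) (hf : DefinableGraph M x f) (hg : DefinableGraph M x g) :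
    DefinableGraph M x fun c => Nat.pair <$> f c <*> g c :=
  .of_iff (P := fun a _ => ∃ u, u ∈ f (a 0) ∧ ∃ v, v ∈ g (a 0) ∧ a 1 = Nat.pair u v)
    (.exTime (.and (hf.mem _ _) (.exTime (.and (hg.mem _ _) (hc.eq_pair _ _ _)))))
    fun _ _ => by simp [Seq.seq, eq_comm]

theorem comp (hf : DefinableGraph M x f) (hg : DefinableGraph M x g) :
    DefinableGraph M x fun c => g c >>= f :=
  .of_iff (P := fun a _ => ∃ u, u ∈ g (a 0) ∧ a 1 ∈ f u)
    (.exTime (.and (hg.mem _ _) (hf.mem _ _))) fun _ _ => Part.mem_bind_iff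

theorem prec (hc : DefinesCard M x) (hf : DefinableGraph M x f) (hg : DefinableGraph M x g) :
    DefinableGraph M x (Nat.unpaired fun a n =>
      n.rec (f a) fun i ih => do let v ← ih; g (Nat.pair a (Nat.pair i v))) := by
  refine Definable.of_iff (P := fun a _ => ∃ b r, a 0 = Nat.pair b r ∧
    ∃ U, (∃ p, p = Nat.pair r (a 1) ∧ p ∈ U) ∧ IsPrecTrace f g b U) ?_ fun a _ => ?_
  · exact .exTime (.exTime (.and (hc.eq_pair _ _ _) (.exSet (.and
      (.exTime (.and (hc.eq_pair _ _ _) (.mem _ _))) (isPrecTrace hc hf hg _ _)))))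
  · simp only [exists_eq_left]
    refine mem_prec_iff_exists_isPrecTrace.trans ⟨fun h => ⟨_, _, (Nat.pair_unpair _).symm, h⟩, ?_⟩
    rintro ⟨b, r, hbr, h⟩
    rwa [hbr, Nat.unpair_pair]

theorem rfind (hc : DefinesCard M x) (hf : DefinableGraph M x f) :
    DefinableGraph M x fun a =>
      Nat.rfind fun n => (fun y => decide (y = 0)) <$> f (Nat.pair a n) := by
  refine Definable.of_iff (P := fun a _ =>
    (∃ p, p = Nat.pair (a 0) (a 1) ∧ ∃ y, y = 0 ∧ y ∈ f p) ∧
      ∀ u, u < a 1 → ∃ p, p = Nat.pair (a 0) u ∧ ∃ y, ¬ y = 0 ∧ y ∈ f p) ?_ fun a _ => ?_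
  · exact .and (.exTime (.and (hc.eq_pair _ _ _) (.exTime (.and (.eq_zero _) (hf.mem _ _)))))
      (.allTime (.imp (.lt _ _) (.exTime (.and (hc.eq_pair _ _ _)
        (.exTime (.and (.not (.eq_zero _)) (hf.mem _ _)))))))
  · exact Nat.mem_rfind.trans (by simp [and_comm])

end DefinableGraph

theorem DefinesCard.definableGraph {k : ℕ} {M : PODTMC k} {x : Recall} (hc : DefinesCard M x)
    {f : ℕ →. ℕ} (hf : Nat.Partrec f) : DefinableGraph M x f := by
  induction hf with
  | zero => exact .zero
  | succ => exact .succ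
  | left => exact .left hc
  | right => exact .right hc
  | pair _ _ ihf ihg => exact .pair hc ihf ihg
  | comp _ _ ihf ihg => exact .comp ihf ihg
  | prec _ _ ihf ihg => exact .prec hc ihf ihg
  | rfind _ ihf => exact .rfind hc ihf

/-! ### The reduction -/

theorem primrec_pow_left (c : ℕ) : Primrec fun n => c ^ n :=
  have hmul : Primrec₂ fun _ y : ℕ => y * c := Primrec.nat_mul.comp .snd (.const c)
  (Primrec.nat_rec₁ 1 hmul).of_eq fun n => by
    induction n with
    | zero => rfl
    | succ n ih => exact (congrArg (· * c) ih).trans (pow_succ c n).symm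

theorem ratCode_of_nonneg {q : ℚ} (hq : 0 ≤ q) :
    ratCode q = Nat.pair (2 * q.num.toNat) q.den := by
  lift q.num to ℕ using Rat.num_nonneg.2 hq with c hc
  rw [ratCode, ← hc]
  rfl

theorem primrec_ratCode_pow {q : ℚ} (hq : 0 ≤ q) : Primrec fun n => ratCode (q ^ n) :=
  (Primrec₂.natPair.comp (Primrec.nat_mul.comp (.const 2) (primrec_pow_left q.num.toNat))
    (primrec_pow_left q.den)).of_eq fun n => by
      rw [ratCode_of_nonneg (pow_nonneg hq n), Rat.num_pow, Rat.den_pow,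
        Int.toNat_pow_of_nonneg (Rat.num_nonneg.2 hq)]

namespace Formula

variable {k : ℕ} {M : PODTMC k} {x : Recall} {p : ℕ} {q : ℚ} {φ : Formula k}
  {P : (Fin 1 → ℕ) → (Fin 0 → Finset ℕ) → Prop}

/-- The instance of `φ` in which the time variable `0` has the value `n`, on the chains where
`eqNumeral p q` expresses equality with a number. -/
def instantiate (φ : Formula k) (p : ℕ) (q : ℚ) (n : ℕ) : Formula k :=
  .allTime 0 ((eqNumeral p q 1 0 n).imp φ)

theorem primrec_code_instantiate (φ : Formula k) (p : ℕ) (hq : 0 ≤ q) :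
    Primrec fun n => (φ.instantiate p q n).code := by
  have hpair (c : ℕ) {f : ℕ → ℕ} (hf : Primrec f) : Primrec fun n => Nat.pair c (f n) :=
    Primrec₂.natPair.comp (.const c) hf
  have hnumeral : Primrec fun n => (eqNumeral (k := k) p q 1 0 n).code :=
    hpair _ <| hpair _ <| hpair _ <| primrec_ratCode_pow hq
  exact hpair _ <| hpair _ <| hpair _ <| hpair _ <|
    Primrec₂.natPair.comp hnumeral (.const (Formula.neg φ).code)

theorem LinearGlobal.instantiate (hφ : φ.LinearGlobal) (p : ℕ) (q : ℚ) (n : ℕ) :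
    (φ.instantiate p q n).LinearGlobal := by
  simp [Formula.instantiate, eqNumeral, allHeads, imp, LinearGlobal, PExpr.LinearGlobal, hφ]

namespace Defines

theorem isSentence_instantiate (hφ : φ.Defines M x (fun _ => 0) Fin.elim0 P) (p : ℕ) (q : ℚ)
    (n : ℕ) : (φ.instantiate p q n).IsSentence := by
  have htime : ∀ t ∈ φ.freeTime, t = 0 := by simpa using hφ.freeTime_subset
  have hset : φ.freeSet = ∅ := by simpa using hφ.freeSet_subset
  constructor
  · ext t
    have ht := htime t
    simp only [instantiate, eqNumeral, allHeads, imp, freeTime, PExpr.freeTime, Finset.mem_erase,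
      Finset.mem_union, Finset.mem_insert, Finset.mem_singleton, Finset.notMem_empty]
    tauto
  · simp [instantiate, eqNumeral, allHeads, imp, freeSet, PExpr.freeSet, hset]

theorem models_instantiate (hφ : φ.Defines M x (fun _ => 0) Fin.elim0 P)
    (hM : M.IsBernoulli p q) (h0 : 0 < q) (h1 : q < 1) (n : ℕ) :
    M.Models x (φ.instantiate p q n) ↔ P (fun _ => n) Fin.elim0 := by
  have hempty (s : Fin 0 → Finset ℕ) : s = Fin.elim0 := Subsingleton.elim _ _
  have hsat (τ ρ) : (φ.instantiate p q n).Sat M x τ ρ ↔ P (fun _ => n) Fin.elim0 := by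
    simp [instantiate, Sat, hM.sat_eqNumeral h0 h1 zero_ne_one, hφ.sat_iff, hempty]
  have : Nonempty M.Path := MeasureTheory.nonempty_of_isProbabilityMeasure M.pathMeasure
  have : Nonempty Assignment := ⟨⟨fun _ => 0, fun _ => ∅⟩⟩
  simp only [PODTMC.Models, hsat, forall_const]

end Defines

end Formula

theorem PODTMC.IsBernoulli.exists_reduction {k : ℕ} {M : PODTMC k} {p : ℕ} {q : ℚ}
    (hM : M.IsBernoulli p q) (h0 : 0 < q) (h1 : q < 1) (x : Recall) {α : Type*} [Primcodable α]
    {P : α → Prop} (hP : REPred P) :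
    ∃ g : α → Formula k, Computable (fun a => (g a).code) ∧
      ∀ a, (g a).IsSentence ∧ (g a).LinearGlobal ∧ (M.Models x (g a) ↔ P a) := by
  obtain ⟨f, hf, hdom⟩ : ∃ f : ℕ →. ℕ, Nat.Partrec f ∧
      ∀ a, (f (Encodable.encode a)).Dom ↔ P a :=
    ⟨_, hP, fun a => by simp [Part.assert]⟩
  have hdef : Definable M x fun (a : Fin 1 → ℕ) (_ : Fin 0 → Finset ℕ) => ∃ y, y ∈ f (a 0) :=
    .exTime (((hM.definesCard h0 h1).definableGraph hf).mem _ _)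
  obtain ⟨φ, hφ⟩ := hdef (fun _ => 0) Fin.elim0
  refine ⟨fun a => φ.instantiate p q (Encodable.encode a),
    (Formula.primrec_code_instantiate φ p h0.le).to_comp.comp Computable.encode, fun a =>
    ⟨hφ.isSentence_instantiate p q _, hφ.linearGlobal.instantiate p q _, ?_⟩⟩
  rw [hφ.models_instantiate hM h0 h1, ← Part.dom_iff_mem, hdom]

theorem computablePred_of_partrec {α : Type*} [Primcodable α] {P : α → Prop} {d : α →. Bool}
    (hd : Partrec d) (h : ∀ a, ∃ b ∈ d a, (b = true ↔ P a)) : ComputablePred P := by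
  classical
  refine ⟨fun _ => inferInstance, hd.of_eq fun a => Part.eq_some_iff.2 ?_⟩
  obtain ⟨b, hb, hP⟩ := h a
  convert hb
  exact Bool.eq_iff_iff.2 (decide_eq_true_iff.trans hP.symm)

end WMLO

theorem theorem3_general {k : ℕ} (x : WMLO.Recall) {M : WMLO.PODTMC k} {p : ℕ} {q : ℚ}
    (hM : M.IsBernoulli p q) (h0 : 0 < q) (h1 : q < 1) :
    ¬ ∃ d : ℕ →. Bool, Partrec d ∧
      ∀ φ : WMLO.Formula k, φ.IsSentence → φ.LinearGlobal →
        ∃ b ∈ d φ.code, (b = true ↔ M.Models x φ) := by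
  rintro ⟨d, hd, h⟩
  obtain ⟨g, hg, hmodels⟩ := hM.exists_reduction h0 h1 x (ComputablePred.halting_problem_re 0)
  refine ComputablePred.halting_problem 0 (WMLO.computablePred_of_partrec (hd.comp hg) fun c => ?_)
  obtain ⟨hsent, hlin, hiff⟩ := hmodels c
  simpa only [hiff] using h (g c) hsent hlin

theorem theorem3 (k : ℕ) (x : WMLO.Recall) :
    ¬ ∃ d : (ℕ × List ℕ × List (List ℕ) × List (List ℕ) × List (List ℕ)) × ℕ →. Bool,
      Partrec d ∧
        ∀ (M : WMLO.PODTMC k) (φ : WMLO.Formula k), φ.IsSentence → φ.LinearGlobal →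
          ∃ b ∈ d (M.code, φ.code), (b = true ↔ M.Models x φ) := by
  rintro ⟨d, hd, h⟩
  exact theorem3_general x (WMLO.coin_isBernoulli k) (by norm_num) (by norm_num)
    ⟨_, hd.comp ((Computable.const _).pair Computable.id), h (WMLO.coin k)⟩
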